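/- Let $\nu\ge 2$, $1\le k\le\nu$ and $0<r<1/4$ be given. Two hard balls of radius $r$ and unit mass move in the container $[-r,1+r]^k\times\mathbb T^{\nu-k}$, $\mathbb T=\mathbb R/\mathbb Z$, and are reflected elastically at each other and at the walls. Write $q_i\in[0,1]^k\times\mathbb T^{\nu-k}$ for the centers and $v_i\in\mathbb R^\nu=\mathbb R^k\oplus\mathbb R^{\nu-k}$ for the velocities ($i=1,2$), let $P:\mathbb R^\nu\to\mathbb R^{\nu-k}$ be the projection to the periodic component and $\pi_2$ the projection of a position to $\mathbb T^{\nu-k}$, and normalize by $\|v_1\|^2+\|v_2\|^2=1$, $\pi_2(q_1+q_2)=0$, $P(v_1+v_2)=0$. The configuration space $\mathbf Q$ consists of the pairs $(q_1,q_2)$ with $\operatorname{dist}(q_1,q_2)\ge 2r$ and $\pi_2(q_1+q_2)=0$; it has dimension $d=\nu+k$. The phase space is $\mathbf M=\mathbf Q\times\mathbb S^{d-1}$; over $\partial\mathbf Q$ the incoming and the outgoing velocities represent the same state. A subset of $\mathbf M$ is called slim if it can be covered by countably many closed sets of topological dimension at most $\dim\mathbf M-2=2d-3$ and of measure zero (for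 a smooth measure on $\mathbf M$). A trajectory $S^{(-\infty,\infty)}x_0=\{(q_1^t,q_2^t;v_1^t,v_2^t):t\in\mathbb R\}$ (with $x_0$ the state at time $0$) is called non-singular if it never meets two of the smooth pieces of $\partial\mathbf Q$ at the same time and the moments of collision do not accumulate. A ball-to-ball collision is a contact of the two balls at which they bounce off each other, i.e. at which the velocities change (a grazing contact, which leaves the velocities unchanged, does not count). **Lemma 4.1.** There exist finitely many nonzero vectors $z_1,\dots,z_l\in\mathbb R^{\nu-k}$ and a slim set $E\subset\mathbf M$ (all depending only on $\nu,k,r$) with the following property. If a non-singular trajectory $S^{(-\infty,\infty)}x_0$ has no ball-to-ball collision on a time interval $(t_0,\infty)$, then either (1) $x_0\in E$ (for each of its representatives, if $x_0$ lies over $\partial\mathbf Q$), or (2) the projection $P(v_1^{t_0}-v_2^{t_0})\in\mathbb R^{\nu-k}$ of the relative velocity at time $t_0$ is perpendicular to some $z_i$. In either case the entire trajectory $S^{(-\infty,\infty)}x_0$ does not contain a single ball-to-ball collision. -/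

import Mathlib

/- Two hard balls of radius `r` and unit mass in the container `[-r, 1 + r]^k × 𝕋^m`; the dimension
of the container is `ν = k + m`. The coordinates `Sum.inl j` are the non-periodic ones, the
coordinates `Sum.inr j` are the periodic ones. The two balls are numbered `0` and `1`. -/

namespace TwoBalls

/-- Vectors of `ℝ^ν = ℝ^k ⊕ ℝ^m` with the Euclidean norm (velocities and displacements). -/
abbrev Velocity (k m : ℕ) := EuclideanSpace ℝ (Fin k ⊕ Fin m)

/-- Positions of the center of a ball, in `ℝ^k × 𝕋^m` with `𝕋 = ℝ / ℤ`. -/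
abbrev Center (k m : ℕ) := (Fin k → ℝ) × (Fin m → UnitAddCircle)

/-- Pairs (positions of the two centers, velocities of the two balls). -/
abbrev State (k m : ℕ) := (Fin 2 → Center k m) × (Fin 2 → Velocity k m)

instance (k m : ℕ) : BorelSpace (Center k m) := inferInstance

instance (k m : ℕ) : BorelSpace (Fin 2 → Center k m) :=
  have : ∀ _ : Fin 2, BorelSpace (Center k m) := fun _ => inferInstance
  Pi.borelSpace

/-- The covering map `ℝ^k ⊕ ℝ^m → ℝ^k × 𝕋^m`. -/
def toCenter {k m : ℕ} (u : Velocity k m) : Center k m :=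
  (fun j => u (Sum.inl j), fun j => (u (Sum.inr j) : UnitAddCircle))

/-- The component in `ℝ^m` (the periodic directions) of a vector of `ℝ^k ⊕ ℝ^m`. -/
noncomputable def periodicPart {k m : ℕ} (u : Velocity k m) : EuclideanSpace ℝ (Fin m) :=
  WithLp.toLp 2 fun j => u (Sum.inr j)

/-- The Euclidean distance in `ℝ^k × 𝕋^m`; the norm on `𝕋` is the distance to `0`. -/
noncomputable def centerDist {k m : ℕ} (p q : Center k m) : ℝ :=
  √(∑ j, (p.1 j - q.1 j) ^ 2 + ∑ j, ‖p.2 j - q.2 j‖ ^ 2)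

/-- The configuration space `Q`. -/
def configSpace (k m : ℕ) (r : ℝ) : Set (Fin 2 → Center k m) :=
  {q | (∀ i j, (q i).1 j ∈ Set.Icc (0 : ℝ) 1) ∧ 2 * r ≤ centerDist (q 0) (q 1) ∧
    ∀ j, (q 0).2 j + (q 1).2 j = 0}

/-- The velocities with `‖v₁‖² + ‖v₂‖² = 1` and zero total momentum in the periodic directions. -/
def velocitySphere (k m : ℕ) : Set (Fin 2 → Velocity k m) :=
  {v | ‖v 0‖ ^ 2 + ‖v 1‖ ^ 2 = 1 ∧ ∀ j, v 0 (Sum.inr j) + v 1 (Sum.inr j) = 0}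

/-- The phase space `M = Q × S^{d-1}`, `d = dim Q = 2k + m`. A phase point over `∂Q` has an incoming
and an outgoing representative here. -/
def phaseSpace (k m : ℕ) (r : ℝ) : Set (State k m) :=
  configSpace k m r ×ˢ velocitySphere k m

/-- `dim M = 2d - 1` with `d = 2k + m`. -/
def phaseDim (k m : ℕ) : ℕ := 2 * (2 * k + m) - 1

/-- Slim subsets of `M`: those covered by countably many closed sets of topological dimension at
most `dim M - 2` and of measure zero. The null sets of a smooth measure on `M` are those of the
Hausdorff measure of dimension `dim M`. -/
def IsSlim {k m : ℕ} {r : ℝ} (A : Set (phaseSpace k m r)) : Prop :=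
  ∃ F : ℕ → Set (phaseSpace k m r),
    (∀ n, IsClosed (F n) ∧ HasSmallInductiveDimensionLE (F n) (phaseDim k m - 2) ∧
      MeasureTheory.Measure.hausdorffMeasure (phaseDim k m : ℝ) (F n) = 0) ∧
    A ⊆ ⋃ n, F n

/-- The smooth pieces of `∂Q`: `wall i j` is the (disjoint) union of the two flat pieces on which
the `j`-th non-periodic coordinate of the `i`-th center is `0` or `1`, and `balls` is the piece on
which the two balls touch each other. -/
inductive Piece (k : ℕ) where
  | wall (i : Fin 2) (j : Fin k) : Piece k
  | balls : Piece k

/-- The configuration `q` lies on the given piece of `∂Q`. -/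
def Touches {k m : ℕ} (r : ℝ) (q : Fin 2 → Center k m) : Piece k → Prop
  | Piece.wall i j => (q i).1 j = 0 ∨ (q i).1 j = 1
  | Piece.balls => centerDist (q 0) (q 1) = 2 * r

/-- `w` is the elastic reflection of the pair of velocities `v` at the given piece of `∂Q` at `q`.
At a wall, one coordinate of the velocity of one ball changes sign. For the two balls, `u` is the
vector of length `2r` from the second center to the first one, and the balls exchange the
components of their velocities in the direction of `u`. -/
def Reflects {k m : ℕ} (r : ℝ) (q : Fin 2 → Center k m) (v w : Fin 2 → Velocity k m) :
    Piece k → Prop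
  | Piece.wall i j => ∀ i' c, w i' c = if i' = i ∧ c = Sum.inl j then -(v i' c) else v i' c
  | Piece.balls => ∃ u : Velocity k m, toCenter u = q 0 - q 1 ∧ ‖u‖ = 2 * r ∧
      w 0 = v 0 - (inner ℝ (v 0 - v 1) u / (2 * r) ^ 2) • u ∧
      w 1 = v 1 + (inner ℝ (v 0 - v 1) u / (2 * r) ^ 2) • u

/-- The non-singular trajectories `S^{(-∞, ∞)} x₀`, `x₀` being the state at time `0`: motions in `Q`
that are defined for all times, never meet two pieces of `∂Q` at the same time, are uniform
on a one-sided neighborhood of every moment on either side (so that the moments of collision do not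
accumulate), and are reflected elastically at `∂Q`. Here `velIn t` and `velOut t` are the velocities
at `t - 0` and `t + 0`. -/
structure NonsingularTrajectory (k m : ℕ) (r : ℝ) where
  pos : ℝ → Fin 2 → Center k m
  velIn : ℝ → Fin 2 → Velocity k m
  velOut : ℝ → Fin 2 → Velocity k m
  pos_mem : ∀ t, pos t ∈ configSpace k m r
  velIn_mem : ∀ t, velIn t ∈ velocitySphere k m
  velOut_mem : ∀ t, velOut t ∈ velocitySphere k m
  after : ∀ t, ∃ ε > 0, ∀ s, 0 < s → s < ε →
    (∀ i, pos (t + s) i = pos t i + toCenter (s • velOut t i)) ∧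
      velIn (t + s) = velOut t ∧ velOut (t + s) = velOut t
  before : ∀ t, ∃ ε > 0, ∀ s, 0 < s → s < ε →
    (∀ i, pos (t - s) i = pos t i - toCenter (s • velIn t i)) ∧
      velIn (t - s) = velIn t ∧ velOut (t - s) = velIn t
  free : ∀ t, (∀ p, ¬ Touches r (pos t) p) → velOut t = velIn t
  reflect : ∀ t p, Touches r (pos t) p → Reflects r (pos t) (velIn t) (velOut t) p
  nonsingular : ∀ t p p', Touches r (pos t) p → Touches r (pos t) p' → p = p'

namespace NonsingularTrajectory

variable {k m : ℕ} {r : ℝ}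

/-- The phase point at time `t`, represented with the incoming velocities. -/
def stateIn (T : NonsingularTrajectory k m r) (t : ℝ) : phaseSpace k m r :=
  ⟨(T.pos t, T.velIn t), ⟨T.pos_mem t, T.velIn_mem t⟩⟩

/-- The phase point at time `t`, represented with the outgoing velocities. -/
def stateOut (T : NonsingularTrajectory k m r) (t : ℝ) : phaseSpace k m r :=
  ⟨(T.pos t, T.velOut t), ⟨T.pos_mem t, T.velOut_mem t⟩⟩

/-- The two balls collide at time `t`: they touch and bounce off each other. A grazing contact,
which leaves the velocities unchanged, is not a collision. -/
def BallCollisionAt (T : NonsingularTrajectory k m r) (t : ℝ) : Prop :=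
  Touches r (T.pos t) Piece.balls ∧ T.velOut t ≠ T.velIn t

end NonsingularTrajectory

end TwoBalls

/-! Halve the wall coordinates, unfold the reflections in the walls, and keep only the relative
position in the periodic directions. While no ball collision occurs, the motion is then a linear
flow `x + t V` on a torus of dimension `2k + m`, and the distance of the centers is a continuous
function `unfoldedDistSq` on that torus. By Kronecker's theorem with relations
(`UnitAddTorus.exists_gt_linear_flow_mem`), the forward orbit accumulates at every `y` with `n · (y
- x) ∈ ℤ` for all integral `n` with `n · V = 0`; so the distance is at least `2r` at all such `y`
(`le_unfoldedDistSq`).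

No collision in the past: the points `x + s V` with `s < 0` are such `y`. At a last collision the
outgoing line, extended backwards, would bring the centers closer than `2r`, a contradiction.

The dichotomy concerns the group of relations `n · V = 0`. Two independent relations put `x₀` into a
countable union of closed sets of codimension 2, which is slim. Otherwise the group is generated by
one `n₀`. If `n₀` is zero or involves a wall coordinate, some admissible `y` has coinciding centers.
If `n₀` is purely periodic but longer than `1 / (4r)`, the hyperplanes `n₀ · y ∈ n₀ · x + ℤ` are so
close together that one passes within `2r` of the origin. There remain the finitely many nonzero
`n₀` of length at most `1 / (4r)`; these are the `z_i`. -/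

/-! ### Hausdorff null sets and small inductive dimension -/

open MeasureTheory Set Filter Topology in
open scoped ENNReal in
-- An Eilenberg-type inequality: a covering piece `t` meets only fibers over `f '' t`, a set of
-- length at most `diam t`, so integrating `diam t ^ n` over the fibers costs at most `diam t ^ (n +
-- 1)`.
theorem ae_hausdorffMeasure_fiber_eq_zero {X : Type*} [MetricSpace X] [MeasurableSpace X]
    [BorelSpace X] {f : X → ℝ} (hf : LipschitzWith 1 f) {s : Set X} {n : ℕ}
    (hs : Measure.hausdorffMeasure ((n + 1 : ℕ) : ℝ) s = 0) :
    ∀ᵐ ρ : ℝ, Measure.hausdorffMeasure (n : ℝ) (s ∩ f ⁻¹' {ρ}) = 0 := by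
  have cover : ∀ j : ℕ, ∃ t : ℕ → Set X, s ⊆ ⋃ i, t i ∧ (∀ i, Metric.ediam (t i) ≤ 2⁻¹ ^ j) ∧
      ∑' i, ⨆ _ : (t i).Nonempty, Metric.ediam (t i) ^ ((n + 1 : ℕ) : ℝ) < 2⁻¹ ^ j := by
    intro j
    have hpos : (0 : ℝ≥0∞) < 2⁻¹ ^ j := ENNReal.pow_pos (by simp) j
    rw [Measure.hausdorffMeasure_apply] at hs
    simp only [ENNReal.iSup_eq_zero] at hs
    have h := hs (2⁻¹ ^ j) hpos
    have h' := h.symm ▸ hpos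
    simp only [iInf_lt_iff] at h'
    obtain ⟨t, h1, h2, h3⟩ := h'
    exact ⟨t, h1, h2, h3⟩
  choose t hcov hdiam hsum using cover
  -- `G j ρ` bounds the `n`-dimensional size of the `j`-th cover of the fiber over `ρ`. Its
  -- integrals are summable in `j`, so `G j ρ → 0` for almost every `ρ`.
  set G : ℕ → ℝ → ℝ≥0∞ := fun j ρ => ∑' i,
    (toMeasurable volume (f '' t j i)).indicator (fun _ => Metric.ediam (t j i) ^ (n : ℝ)) ρ with hG
  have hGm : ∀ j, Measurable (G j) := fun j => Measurable.tsum fun i =>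
    measurable_const.indicator (measurableSet_toMeasurable _ _)
  have hGint : ∀ j, ∫⁻ ρ, G j ρ ≤ 2⁻¹ ^ j := by
    intro j
    refine le_trans ?_ (hsum j).le
    rw [hG, lintegral_tsum fun i =>
      (measurable_const.indicator (measurableSet_toMeasurable _ _)).aemeasurable]
    refine ENNReal.tsum_le_tsum fun i => ?_
    rw [lintegral_indicator_const (measurableSet_toMeasurable _ _), measure_toMeasurable]
    rcases (t j i).eq_empty_or_nonempty with h | h
    · simp [h]
    · have hv : volume (f '' t j i) ≤ Metric.ediam (t j i) :=
        (Real.volume_le_diam _).trans (by simpa using hf.ediam_image_le (t j i))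
      rw [ciSup_pos h]
      calc _ ≤ Metric.ediam (t j i) ^ (n : ℝ) * Metric.ediam (t j i) := by gcongr
        _ = _ := by rw [ENNReal.rpow_natCast, ENNReal.rpow_natCast, pow_succ]
  have htot : ∫⁻ ρ, ∑' j, G j ρ ≠ ∞ := by
    rw [lintegral_tsum fun j => (hGm j).aemeasurable]
    refine ne_top_of_le_ne_top ?_ (ENNReal.tsum_le_tsum hGint)
    rw [ENNReal.tsum_geometric]
    simp
  filter_upwards [ae_lt_top (Measurable.tsum hGm) htot] with ρ hρ
  have hlim : Tendsto (fun j => G j ρ) atTop (𝓝 0) :=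
    ENNReal.tendsto_atTop_zero_of_tsum_ne_top hρ.ne
  refine le_antisymm ?_ zero_le
  -- Only pieces meeting the fiber are kept: for `n = 0` an empty piece would contribute `0 ^ 0 =
  -- 1`.
  have key := Measure.hausdorffMeasure_le_liminf_tsum
    (ι := fun j => {i : ℕ // (t j i ∩ f ⁻¹' {ρ}).Nonempty}) (n : ℝ) (s ∩ f ⁻¹' {ρ}) (l := atTop)
    (fun j => (2⁻¹ : ℝ≥0∞) ^ j) (ENNReal.tendsto_pow_atTop_nhds_zero_of_lt_one (by simp))
    (fun j i => t j i ∩ f ⁻¹' {ρ})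
    (Eventually.of_forall fun j i => (Metric.ediam_mono inter_subset_left).trans (hdiam j i))
    (Eventually.of_forall fun j x hx => by
      obtain ⟨i, hi⟩ := mem_iUnion.1 (hcov j hx.1)
      exact mem_iUnion.2 ⟨⟨i, ⟨x, hi, hx.2⟩⟩, hi, hx.2⟩)
  refine key.trans ?_
  rw [← hlim.liminf_eq]
  refine liminf_le_liminf (Eventually.of_forall fun j => ?_)
  refine le_trans (ENNReal.tsum_le_tsum (g := fun i => (toMeasurable volume (f '' t j i.1)).indicator
    (fun _ => Metric.ediam (t j i.1) ^ (n : ℝ)) ρ) fun i => ?_)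
    (ENNReal.tsum_comp_le_tsum_of_injective Subtype.val_injective _)
  obtain ⟨i, x, hx, hxρ⟩ := i
  have hmem : ρ ∈ toMeasurable volume (f '' t j i) := subset_toMeasurable _ _ ⟨x, hx, hxρ⟩
  rw [indicator_of_mem hmem]
  exact ENNReal.rpow_le_rpow (Metric.ediam_mono inter_subset_left) (Nat.cast_nonneg n)

open MeasureTheory Set Filter Topology in
-- Almost every sphere around a point is null one dimension lower, so balls with null frontier form
-- a basis, and induction applies to the frontiers.
theorem hasSmallInductiveDimensionLT_of_hausdorffMeasure_eq_zero (n : ℕ) :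
    ∀ (X : Type*) [MetricSpace X] [MeasurableSpace X] [BorelSpace X],
      Measure.hausdorffMeasure (n : ℝ) (univ : Set X) = 0 → HasSmallInductiveDimensionLT X n := by
  induction n with
  | zero =>
    intro X _ _ _ h
    rw [hasSmallInductiveDimensionLT_zero_iff]
    by_contra hX
    rw [not_isEmpty_iff] at hX
    have := Measure.one_le_hausdorffMeasure_zero_of_nonempty (univ_nonempty (α := X))
    rw [Nat.cast_zero] at h
    simp [h] at this
  | succ n ih =>
    intro X _ _ _ h
    refine .succ n {U : Set X | IsOpen U ∧ Measure.hausdorffMeasure (n : ℝ) (frontier U) = 0} ?_ ?_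
    · refine TopologicalSpace.isTopologicalBasis_of_isOpen_of_nhds (fun U hU => hU.1) ?_
      intro x V hx hV
      obtain ⟨ε, hε, hball⟩ := Metric.isOpen_iff.1 hV x hx
      have hae := ae_hausdorffMeasure_fiber_eq_zero (f := fun y => dist y x)
        (LipschitzWith.dist_left x) h
      obtain ⟨ρ, hρ, hρ0, hρε⟩ : ∃ ρ : ℝ, Measure.hausdorffMeasure (n : ℝ)
          (univ ∩ (fun y => dist y x) ⁻¹' {ρ}) = 0 ∧ 0 < ρ ∧ ρ < ε := by
        by_contra hcon
        push Not at hcon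
        have hle : volume (Ioo 0 ε) ≤ 0 := by
          refine (measure_mono fun ρ hρ => ?_).trans (ae_iff.1 hae).le
          intro h0
          exact absurd hρ.2 (not_lt.2 (hcon ρ h0 hρ.1))
        simp [Real.volume_Ioo] at hle
        linarith
      refine ⟨Metric.ball x ρ, ⟨Metric.isOpen_ball, ?_⟩, Metric.mem_ball_self hρ0,
        (Metric.ball_subset_ball hρε.le).trans hball⟩
      refine measure_mono_null ?_ hρ
      rw [univ_inter]
      exact Metric.frontier_ball_subset_sphere
    · rintro U ⟨-, hU⟩
      refine ih _ ?_
      rw [← isometry_subtype_coe.hausdorffMeasure_image (Or.inl (Nat.cast_nonneg n)), image_univ,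
        Subtype.range_coe]
      exact hU

/-! ### Kronecker's theorem on the torus -/

namespace UnitAddTorus

open MeasureTheory Topology Filter Set

variable {ι : Type*} [Fintype ι]

theorem mFourier_apply_add (n : ι → ℤ) (x y : UnitAddTorus ι) :
    mFourier n (x + y) = mFourier n x * mFourier n y := by
  simp only [mFourier, ContinuousMap.coe_mk, ← Finset.prod_mul_distrib]
  refine Finset.prod_congr rfl fun i _ => ?_
  simp [fourier_apply, AddCircle.toCircle_add]

theorem mFourier_apply_coe (n : ι → ℤ) (x : ι → ℝ) :
    mFourier n (fun i => (x i : UnitAddCircle)) =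
      Complex.exp (2 * Real.pi * Complex.I * ((∑ i, n i * x i : ℝ) : ℂ)) := by
  simp only [mFourier, ContinuousMap.coe_mk, fourier_coe_apply, ← Complex.exp_sum]
  congr 1
  push_cast
  rw [Finset.mul_sum]
  refine Finset.sum_congr rfl fun i _ => ?_
  ring

/-- A coset of a subgroup of the torus is dense in the set cut out by the characters which are
trivial on the subgroup. -/
theorem exists_add_mem_of_mFourier_eq (H : AddSubgroup (UnitAddTorus ι)) {x y : UnitAddTorus ι}
    (hxy : ∀ n : ι → ℤ, (∀ h ∈ H, mFourier n h = 1) → mFourier n x = mFourier n y)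
    {U : Set (UnitAddTorus ι)} (hU : IsOpen U) (hy : y ∈ U) : ∃ h ∈ H, x + h ∈ U := by
  -- Haar averages over `x + K` and `y + K` agree on characters: a character nontrivial on `H`
  -- averages to `0`, the others agree by `hxy`. By density of trigonometric polynomials they agree
  -- on all continuous functions.
  set K := H.topologicalClosure with hK
  have hKc : IsClosed (K : Set (UnitAddTorus ι)) := H.isClosed_topologicalClosure
  have : CompactSpace K := isCompact_iff_compactSpace.1 hKc.isCompact
  let _ : MeasurableSpace K := borel K
  have : BorelSpace K := ⟨rfl⟩
  let μ : Measure K := Measure.addHaar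
  have hint : ∀ (f : C(UnitAddTorus ι, ℂ)) (z : UnitAddTorus ι),
      Integrable (fun h : K => f (z + h)) μ := fun f z =>
    Continuous.integrable_of_hasCompactSupport (by fun_prop) (HasCompactSupport.of_compactSpace _)
  have hchar : ∀ n : ι → ℤ, ∫ h : K, mFourier n (x + h) ∂μ = ∫ h : K, mFourier n (y + h) ∂μ := by
    intro n
    simp only [mFourier_apply_add, integral_const_mul]
    by_cases hn : ∀ h ∈ H, mFourier n h = 1
    · rw [hxy n hn]
    · push Not at hn
      obtain ⟨h₀, hh₀, hne⟩ := hn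
      have h1 : ∫ h : K, mFourier n (h : UnitAddTorus ι) ∂μ
          = mFourier n h₀ * ∫ h : K, mFourier n (h : UnitAddTorus ι) ∂μ := by
        rw [← integral_const_mul, ← integral_add_left_eq_self
          (fun h : K => mFourier n (h : UnitAddTorus ι)) ⟨h₀, H.le_topologicalClosure hh₀⟩]
        simp only [AddSubgroup.coe_add, mFourier_apply_add]
      have h2 : ∫ h : K, mFourier n (h : UnitAddTorus ι) ∂μ = 0 := by
        have : (1 - mFourier n h₀) * ∫ h : K, mFourier n (h : UnitAddTorus ι) ∂μ = 0 := by
          linear_combination h1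
        exact (mul_eq_zero.1 this).resolve_left (sub_ne_zero.2 hne.symm)
      rw [h2]
      simp
  have hcont : ∀ z : UnitAddTorus ι,
      Continuous fun f : C(UnitAddTorus ι, ℂ) => ∫ h : K, f (z + h) ∂μ := by
    intro z
    refine (LipschitzWith.of_dist_le_mul (K := (μ.real univ).toNNReal) fun f g => ?_).continuous
    rw [dist_eq_norm, ← integral_sub (hint f z) (hint g z), dist_eq_norm, mul_comm,
      Real.coe_toNNReal _ measureReal_nonneg]
    refine norm_integral_le_of_norm_le_const (Eventually.of_forall fun h => ?_)
    exact (f - g).norm_coe_le_norm _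
  have hall : ∀ f : C(UnitAddTorus ι, ℂ),
      ∫ h : K, f (x + h) ∂μ = ∫ h : K, f (y + h) ∂μ := by
    intro f
    have hf : f ∈ closure (Submodule.span ℂ (range (mFourier (d := ι))) :
        Set C(UnitAddTorus ι, ℂ)) := by
      rw [← Submodule.topologicalClosure_coe, span_mFourier_closure_eq_top]
      trivial
    refine closure_minimal (fun g hg => ?_)
      (isClosed_eq (hcont x) (hcont y)) hf
    induction hg using Submodule.span_induction with
    | mem g hg =>
      obtain ⟨n, rfl⟩ := hg
      exact hchar n
    | zero => simp
    | add f g _ _ hf hg =>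
      simp only [mem_ofPred_eq, ContinuousMap.add_apply] at hf hg ⊢
      rw [integral_add (hint _ _) (hint _ _), integral_add (hint _ _) (hint _ _), hf, hg]
    | smul c f _ hf =>
      simp only [mem_ofPred_eq, ContinuousMap.smul_apply, integral_smul] at hf ⊢
      rw [hf]
  by_contra hcon
  push Not at hcon
  have hK' : ∀ h : K, x + (h : UnitAddTorus ι) ∉ U := by
    intro h hh
    have hmem : (h : UnitAddTorus ι) ∈ closure (H : Set (UnitAddTorus ι)) := h.2
    obtain ⟨z, hz, hzH⟩ := mem_closure_iff.1 hmem ((fun z => x + z) ⁻¹' U)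
      (hU.preimage (by fun_prop)) hh
    exact hcon z hzH hz
  -- This test function vanishes on `x + K` if that coset misses `U`, but has positive average over
  -- `y + K`.
  let F : C(UnitAddTorus ι, ℝ) := ⟨fun z => Metric.infDist z Uᶜ, by fun_prop⟩
  have hne : (Uᶜ : Set (UnitAddTorus ι)).Nonempty := ⟨_, hK' 0⟩
  have hFr := hall ⟨fun z => (F z : ℂ), by fun_prop⟩
  simp only [ContinuousMap.coe_mk, integral_complex_ofReal, Complex.ofReal_inj] at hFr
  have hx0 : ∫ h : K, F (x + h) ∂μ = 0 := by
    refine integral_eq_zero_of_ae (Eventually.of_forall fun h => ?_)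
    exact Metric.infDist_zero_of_mem (hK' h)
  have hy0 : 0 < ∫ h : K, F (y + h) ∂μ := by
    refine Continuous.integral_pos_of_hasCompactSupport_nonneg_nonzero (x := 0) (by fun_prop)
      (HasCompactSupport.of_compactSpace _) (fun h => Metric.infDist_nonneg) ?_
    refine ne_of_gt ?_
    have : 0 < Metric.infDist y Uᶜ :=
      (hU.isClosed_compl.notMem_iff_infDist_pos hne).1 (by simpa using hy)
    simpa [F] using this
  rw [hx0] at hFr
  exact hy0.ne hFr

/-- Kronecker's theorem with relations, for the forward orbits of a linear flow. -/
theorem exists_gt_linear_flow_mem {V x y : ι → ℝ}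
    (hxy : ∀ n : ι → ℤ, ∑ i, n i * V i = 0 → ∃ c : ℤ, ∑ i, (n i : ℝ) * (y i - x i) = c)
    {U : Set (UnitAddTorus ι)} (hU : IsOpen U) (hy : (fun i => (y i : UnitAddCircle)) ∈ U)
    (t₁ : ℝ) : ∃ t > t₁, (fun i => ((x i + t * V i : ℝ) : UnitAddCircle)) ∈ U := by
  let φ : ℝ →+ UnitAddTorus ι :=
    { toFun := fun t i => ((t * V i : ℝ) : UnitAddCircle)
      map_zero' := by ext; simp
      map_add' := fun s t => by ext i; simp [add_mul] }
  have hφ : ∀ t, φ t = fun i => ((t * V i : ℝ) : UnitAddCircle) := fun _ => rfl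
  have hsplit : ∀ t, (fun i => ((x i + t * V i : ℝ) : UnitAddCircle)) =
      (fun i => (x i : UnitAddCircle)) + φ t := fun t => by ext i; simp [hφ]
  obtain ⟨h, ⟨t, rfl⟩, hh⟩ := exists_add_mem_of_mFourier_eq φ.range
    (x := fun i => (x i : UnitAddCircle)) (y := fun i => (y i : UnitAddCircle)) (fun n hn => by
      have hV : ∑ i, n i * V i = 0 := by
        by_contra hne
        -- At this time the character has made half a turn and equals `-1`.
        have h1 := hn _ ⟨(2 * ∑ i, n i * V i)⁻¹, rfl⟩
        rw [hφ, mFourier_apply_coe] at h1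
        have h2 : ∑ i, (n i : ℝ) * ((2 * ∑ i, n i * V i)⁻¹ * V i) = 1 / 2 := by
          have : ∀ i, (n i : ℝ) * ((2 * ∑ i, n i * V i)⁻¹ * V i) =
            (2 * ∑ i, n i * V i)⁻¹ * (n i * V i) := fun i => by ring
          rw [Finset.sum_congr rfl fun i _ => this i, ← Finset.mul_sum]
          field_simp
        rw [h2] at h1
        have h3 : (2 * Real.pi * Complex.I * ((1 / 2 : ℝ) : ℂ) : ℂ) = Real.pi * Complex.I := by
          push_cast; ring
        rw [h3, Complex.exp_pi_mul_I] at h1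
        norm_num at h1
      obtain ⟨c, hc⟩ := hxy n hV
      rw [mFourier_apply_coe, mFourier_apply_coe, Complex.exp_eq_exp_iff_exists_int]
      refine ⟨-c, ?_⟩
      have : ∑ i, (n i : ℝ) * x i = ∑ i, (n i : ℝ) * y i - c := by
        rw [← hc, ← Finset.sum_sub_distrib]
        exact Finset.sum_congr rfl fun i _ => by ring
      rw [this]
      push_cast
      ring) hU hy
  -- The time found may be too early. Differences of convergent subsequence times are near-returns
  -- to the origin, each of length at least `|t₁| + |t| + 1`; adding one pushes the time beyond
  -- `t₁`.
  obtain ⟨a, -, g, hg, hlim⟩ := isCompact_univ.tendsto_subseq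
    (x := fun N : ℕ => φ (N * (|t₁| + |t| + 1))) (fun _ => mem_univ _)
  have hdiff : Tendsto (fun j => (fun i => (x i : UnitAddCircle)) + φ t +
      (φ (g (j + 1) * (|t₁| + |t| + 1)) - φ (g j * (|t₁| + |t| + 1)))) atTop
      (𝓝 ((fun i => (x i : UnitAddCircle)) + φ t + (a - a))) :=
    tendsto_const_nhds.add (((tendsto_add_atTop_iff_nat 1).2 hlim).sub hlim)
  rw [sub_self, add_zero] at hdiff
  obtain ⟨j, hj⟩ := (hdiff.eventually (hU.mem_nhds hh)).exists
  refine ⟨t + (g (j + 1) * (|t₁| + |t| + 1) - g j * (|t₁| + |t| + 1)), ?_, ?_⟩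
  · have h1 : (g j : ℝ) + 1 ≤ g (j + 1) := by exact_mod_cast hg (Nat.lt_succ_self j)
    have h2 := neg_abs_le t
    have h3 := le_abs_self t₁
    nlinarith [abs_nonneg t, abs_nonneg t₁]
  · rw [hsplit, map_add, map_sub, ← add_assoc]
    exact hj

end UnitAddTorus

/-! ### Relation groups of rank at most one, and linear and metric auxiliaries -/

theorem AddSubgroup.exists_forall_eq_zsmul_of_minors_eq_zero {ι : Type*} (Λ : AddSubgroup (ι → ℤ))
    (h : ∀ n ∈ Λ, ∀ n' ∈ Λ, ∀ a b, n a * n' b = n b * n' a) :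
    ∃ n₀ ∈ Λ, ∀ n ∈ Λ, ∃ c : ℤ, n = c • n₀ := by
  by_cases hΛ : ∀ n ∈ Λ, n = 0
  · exact ⟨0, Λ.zero_mem, fun n hn => ⟨0, by simp [hΛ n hn]⟩⟩
  · push Not at hΛ
    obtain ⟨n, hn, hne⟩ := hΛ
    obtain ⟨a, ha⟩ := Function.ne_iff.1 hne
    -- Since all elements are proportional to `n` and `n a ≠ 0`, the coordinate `a` determines an
    -- element; so `Λ` embeds in `ℤ`.
    let f : Λ →+ ℤ := (Pi.evalAddMonoidHom (fun _ : ι => ℤ) a).comp Λ.subtype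
    have hf : Function.Injective f := by
      rw [injective_iff_map_eq_zero]
      rintro ⟨n', hn'⟩ h0
      have h0' : n' a = 0 := h0
      ext b
      have := h n hn n' hn' a b
      rw [h0', mul_zero] at this
      exact (mul_eq_zero.1 this).resolve_left ha
    have : IsAddCyclic Λ := isAddCyclic_of_injective f hf
    obtain ⟨g, hg⟩ := IsAddCyclic.exists_generator (α := Λ)
    refine ⟨g, g.2, fun n' hn' => ?_⟩
    obtain ⟨c, hc⟩ := AddSubgroup.mem_zmultiples_iff.1 (hg ⟨n', hn'⟩)
    exact ⟨c, by simpa using congrArg Subtype.val hc.symm⟩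

open MeasureTheory in
theorem hausdorffMeasure_finrank_prod_sphere_eq_zero (E F : Type*) [NormedAddCommGroup E]
    [NormedSpace ℝ E] [FiniteDimensional ℝ E] [MeasurableSpace E] [BorelSpace E]
    [NormedAddCommGroup F] [NormedSpace ℝ F] [FiniteDimensional ℝ F] [MeasurableSpace F]
    [BorelSpace F] :
    Measure.hausdorffMeasure (Module.finrank ℝ (E × F) : ℝ) {p : E × F | ‖p.2‖ = 1} = 0 := by
  have : ProperSpace E := FiniteDimensional.proper_real E
  have : ProperSpace F := FiniteDimensional.proper_real F
  have hac := Measure.absolutelyContinuous_isAddHaarMeasure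
    (Measure.hausdorffMeasure (Module.finrank ℝ (E × F) : ℝ) : Measure (E × F))
    ((Measure.addHaar : Measure E).prod (Measure.addHaar : Measure F))
  refine hac ?_
  have hset : {p : E × F | ‖p.2‖ = 1} = Set.univ ×ˢ Metric.sphere (0 : F) 1 := by
    ext p; simp
  rw [hset, Measure.prod_prod, Measure.addHaar_sphere_of_ne_zero _ _ one_ne_zero, mul_zero]

theorem finrank_ker_pair_of_minor_ne_zero {ι : Type*} [Fintype ι] {n n' : ι → ℝ} {a b : ι}
    (h : n a * n' b ≠ n b * n' a) (A : (ι → ℝ) →ₗ[ℝ] ℝ × ℝ)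
    (hA : ∀ u, A u = (∑ i, n i * u i, ∑ i, n' i * u i)) :
    Module.finrank ℝ (LinearMap.ker A) + 2 = Fintype.card ι := by
  classical
  have hsurj : LinearMap.range A = ⊤ := by
    rw [LinearMap.range_eq_top]
    rintro ⟨p, q⟩
    have hD : n a * n' b - n b * n' a ≠ 0 := sub_ne_zero.2 h
    -- Cramer's rule in the coordinates `a` and `b`.
    refine ⟨((p * n' b - q * n b) / (n a * n' b - n b * n' a)) • Pi.single a 1 +
      ((q * n a - p * n' a) / (n a * n' b - n b * n' a)) • Pi.single b 1, ?_⟩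
    rw [hA]
    simp only [Pi.add_apply, Pi.smul_apply, Pi.single_apply, smul_eq_mul, mul_ite, mul_one,
      mul_zero, mul_add, Finset.sum_add_distrib, Finset.sum_ite_eq', Finset.mem_univ, if_true,
      Prod.mk.injEq]
    constructor <;> rw [mul_div_assoc', mul_div_assoc', ← add_div, div_eq_iff hD] <;> ring
  have := A.finrank_range_add_finrank_ker
  rw [hsurj, finrank_top, Module.finrank_prod, Module.finrank_self, Module.finrank_pi] at this
  omega

theorem lipschitzWith_coe_unitAddCircle : LipschitzWith 1 ((↑) : ℝ → UnitAddCircle) := by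
  refine LipschitzWith.of_dist_le_mul fun a b => ?_
  rw [dist_eq_norm, ← AddCircle.coe_sub, NNReal.coe_one, one_mul, Real.dist_eq]
  exact QuotientAddGroup.norm_mk_le_norm

/-! ### The slim set of doubly resonant phase points -/

namespace TwoBalls

open MeasureTheory

variable {k m : ℕ} {r : ℝ}

/-- The velocities of the coordinates `(q i).1 j / 2` and `(q 0).2 j - (q 1).2 j`. -/
noncomputable def frequency (v : Fin 2 → Velocity k m) : (Fin 2 × Fin k) ⊕ Fin m → ℝ :=
  Sum.elim (fun p => v p.1 (Sum.inl p.2) / 2) fun j => v 0 (Sum.inr j) - v 1 (Sum.inr j)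

/-- The phase points whose frequencies satisfy the two linear relations `n` and `n'`. -/
def resonantSet (r : ℝ) (n n' : (Fin 2 × Fin k) ⊕ Fin m → ℤ) : Set (phaseSpace k m r) :=
  {x | ∑ c, n c * frequency x.1.2 c = 0 ∧ ∑ c, n' c * frequency x.1.2 c = 0}

theorem continuous_frequency (c : (Fin 2 × Fin k) ⊕ Fin m) :
    Continuous fun v : Fin 2 → Velocity k m => frequency v c := by
  rcases c with p | j <;> simp only [frequency, Sum.elim_inl, Sum.elim_inr] <;> fun_prop

theorem isClosed_resonantSet (n n' : (Fin 2 × Fin k) ⊕ Fin m → ℤ) :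
    IsClosed (resonantSet r n n') := by
  have h : ∀ n : (Fin 2 × Fin k) ⊕ Fin m → ℤ,
      Continuous fun x : phaseSpace k m r => ∑ c, n c * frequency x.1.2 c := fun n =>
    continuous_finsetSum _ fun c _ => continuous_const.mul
      ((continuous_frequency c).comp (continuous_snd.comp continuous_subtype_val))
  exact (isClosed_eq (h n) continuous_const).inter (isClosed_eq (h n') continuous_const)

/-- The pair of velocities with zero total momentum in the periodic directions and with the given
frequencies. -/
noncomputable def velocityOfFrequency (k m : ℕ) :
    ((Fin 2 × Fin k) ⊕ Fin m → ℝ) →ₗ[ℝ] PiLp 2 (fun _ : Fin 2 => Velocity k m) where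
  toFun u := WithLp.toLp 2 fun i => WithLp.toLp 2 <|
    Sum.elim (fun j => 2 * u (Sum.inl (i, j)))
      (fun j => if i = 0 then u (Sum.inr j) / 2 else -(u (Sum.inr j) / 2))
  map_add' u u' := by
    ext i c
    rcases c with j | j
    · simp [mul_add]
    · simp only [PiLp.add_apply, Sum.elim_inr, Pi.add_apply]
      split_ifs <;> ring
  map_smul' a u := by
    ext i c
    rcases c with j | j
    · simp only [PiLp.smul_apply, Sum.elim_inl, Pi.smul_apply, smul_eq_mul, RingHom.id_apply]
      ring
    · simp only [PiLp.smul_apply, Sum.elim_inr, Pi.smul_apply, smul_eq_mul, RingHom.id_apply]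
      split_ifs <;> ring

theorem velocityOfFrequency_frequency {v : Fin 2 → Velocity k m}
    (hv : ∀ j, v 0 (Sum.inr j) + v 1 (Sum.inr j) = 0) :
    velocityOfFrequency k m (frequency v) = WithLp.toLp 2 v := by
  ext i c
  rcases c with j | j
  · simp only [velocityOfFrequency, frequency, LinearMap.coe_mk, AddHom.coe_mk, Sum.elim_inl]
    ring
  · simp only [velocityOfFrequency, frequency, LinearMap.coe_mk, AddHom.coe_mk, Sum.elim_inr]
    have := hv j
    fin_cases i
    · simp only [Fin.zero_eta, if_true]; linarith
    · simp only [Fin.mk_one, one_ne_zero, if_false]; linarith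

/-- Configurations with `(q 0).2 = -(q 1).2` from real coordinates. -/
def configOfCoords (p : (Fin 2 → Fin k → ℝ) × (Fin m → ℝ)) : Fin 2 → Center k m := fun i =>
  (p.1 i, fun j => if i = 0 then (p.2 j : UnitAddCircle) else -(p.2 j : UnitAddCircle))

theorem lipschitzWith_configOfCoords :
    LipschitzWith 1 (configOfCoords (k := k) (m := m)) := by
  refine LipschitzWith.of_edist_le fun p p' => ?_
  refine edist_pi_le_iff.2 fun i => ?_
  refine max_le ?_ ?_
  · exact (edist_le_pi_edist p.1 p'.1 i).trans (le_max_left _ _)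
  · refine edist_pi_le_iff.2 fun j => ?_
    refine le_trans ?_ ((edist_le_pi_edist p.2 p'.2 j).trans (le_max_right _ _))
    have h := lipschitzWith_coe_unitAddCircle.edist_le_mul (p.2 j) (p'.2 j)
    rw [ENNReal.coe_one, one_mul] at h
    simp only [configOfCoords]
    split_ifs
    · exact h
    · rwa [edist_neg_neg]

theorem exists_configOfCoords_eq {q : Fin 2 → Center k m} (hq : ∀ j, (q 0).2 j + (q 1).2 j = 0) :
    ∃ p, configOfCoords p = q := by
  choose y hy using fun j => QuotientAddGroup.mk_surjective ((q 0).2 j)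
  refine ⟨(fun i => (q i).1, y), ?_⟩
  funext i
  refine Prod.ext rfl ?_
  funext j
  have hy' : (y j : UnitAddCircle) = (q 0).2 j := hy j
  fin_cases i
  · simpa [configOfCoords] using hy'
  · simp only [configOfCoords, Fin.mk_one, one_ne_zero, if_false, hy']
    exact neg_eq_of_add_eq_zero_right (hq j)

/-- With `d = 2k + m`, the set lies in a 1-Lipschitz image of `ℝ^d` times the unit sphere of a space
`W` of dimension at most `d - 2`. That sphere is null in `W`, so the measure of dimension `2d - 2`
vanishes, which is what inductive dimension at most `2d - 3` requires. -/
theorem hausdorffMeasure_resonantSet (hd : 2 ≤ 2 * k + m) {n n' : (Fin 2 × Fin k) ⊕ Fin m → ℤ}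
    {a b : (Fin 2 × Fin k) ⊕ Fin m} (h : n a * n' b ≠ n b * n' a) :
    Measure.hausdorffMeasure ((phaseDim k m - 2 + 1 : ℕ) : ℝ) (resonantSet r n n') = 0 := by
  let A : ((Fin 2 × Fin k) ⊕ Fin m → ℝ) →ₗ[ℝ] ℝ × ℝ :=
    (∑ c, (n c : ℝ) • LinearMap.proj c).prod (∑ c, (n' c : ℝ) • LinearMap.proj c)
  have hA : ∀ u, A u = (∑ c, (n c : ℝ) * u c, ∑ c, (n' c : ℝ) * u c) := fun u => by simp [A]
  have hker := finrank_ker_pair_of_minor_ne_zero (n := fun c => (n c : ℝ))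
    (n' := fun c => (n' c : ℝ)) (a := a) (b := b) (by exact_mod_cast h) A hA
  let W := (LinearMap.ker A).map (velocityOfFrequency k m)
  have hW : Module.finrank ℝ W ≤ Module.finrank ℝ (LinearMap.ker A) := Submodule.finrank_map_le _ _
  let _ : MeasurableSpace W := borel W
  have : BorelSpace W := ⟨rfl⟩
  let G : ((Fin 2 → Fin k → ℝ) × (Fin m → ℝ)) × W → State k m :=
    fun p => (configOfCoords p.1, WithLp.ofLp (p.2 : PiLp 2 (fun _ : Fin 2 => Velocity k m)))
  have hG : LipschitzWith 1 G := by
    have h1 := (lipschitzWith_configOfCoords (k := k) (m := m)).comp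
      (LipschitzWith.prod_fst (α := (Fin 2 → Fin k → ℝ) × (Fin m → ℝ)) (β := W))
    have h2 := (PiLp.lipschitzWith_ofLp 2 (fun _ : Fin 2 => Velocity k m)).comp
      ((LipschitzWith.subtype_val (W : Set (PiLp 2 (fun _ : Fin 2 => Velocity k m)))).comp
        (LipschitzWith.prod_snd (α := (Fin 2 → Fin k → ℝ) × (Fin m → ℝ)) (β := W)))
    simpa using h1.prodMk h2
  have hdim : Module.finrank ℝ (((Fin 2 → Fin k → ℝ) × (Fin m → ℝ)) × W) ≤
      phaseDim k m - 2 + 1 := by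
    have h1 : Module.finrank ℝ (Fin 2 → Fin k → ℝ) = 2 * k := by
      rw [Module.finrank_pi_fintype]; simp
    rw [Module.finrank_prod, Module.finrank_prod, h1, Module.finrank_pi]
    simp only [Fintype.card_sum, Fintype.card_prod, Fintype.card_fin] at hker ⊢
    unfold phaseDim
    omega
  have hnull := le_antisymm ((Measure.hausdorffMeasure_mono (Nat.cast_le.2 hdim) _).trans
    (hausdorffMeasure_finrank_prod_sphere_eq_zero _ _).le) zero_le
  have himage := hG.hausdorffMeasure_image_le (Nat.cast_nonneg (phaseDim k m - 2 + 1))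
    {p : ((Fin 2 → Fin k → ℝ) × (Fin m → ℝ)) × W | ‖p.2‖ = 1}
  rw [hnull, mul_zero] at himage
  rw [← isometry_subtype_coe.hausdorffMeasure_image (Or.inl (Nat.cast_nonneg _))]
  refine measure_mono_null ?_ (le_antisymm himage zero_le)
  rintro _ ⟨⟨⟨q, v⟩, ⟨_, _, hq⟩, hv1, hv⟩, hx, rfl⟩
  obtain ⟨p, rfl⟩ := exists_configOfCoords_eq hq
  have hvW : WithLp.toLp 2 v ∈ W := by
    refine ⟨frequency v, ?_, velocityOfFrequency_frequency hv⟩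
    rw [SetLike.mem_coe, LinearMap.mem_ker, hA]
    exact Prod.ext hx.1 hx.2
  refine ⟨(p, ⟨WithLp.toLp 2 v, hvW⟩), ?_, rfl⟩
  show ‖WithLp.toLp 2 v‖ = 1
  rw [PiLp.norm_eq_of_L2, Fin.sum_univ_two]
  exact (congrArg Real.sqrt hv1).trans Real.sqrt_one

/-- The phase points whose frequencies satisfy two independent integral relations. -/
def doublyResonantSet (k m : ℕ) (r : ℝ) : Set (phaseSpace k m r) :=
  ⋃ (p : {p : ((Fin 2 × Fin k) ⊕ Fin m → ℤ) × ((Fin 2 × Fin k) ⊕ Fin m → ℤ) //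
    ∃ a b, p.1 a * p.2 b ≠ p.1 b * p.2 a}), resonantSet r p.1.1 p.1.2

theorem isSlim_doublyResonantSet (hd : 2 ≤ 2 * k + m) : IsSlim (doublyResonantSet k m r) := by
  have hall : ∀ p : {p : ((Fin 2 × Fin k) ⊕ Fin m → ℤ) × ((Fin 2 × Fin k) ⊕ Fin m → ℤ) //
      ∃ a b, p.1 a * p.2 b ≠ p.1 b * p.2 a}, IsClosed (resonantSet r p.1.1 p.1.2) ∧
      HasSmallInductiveDimensionLE (resonantSet r p.1.1 p.1.2) (phaseDim k m - 2) ∧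
      Measure.hausdorffMeasure (phaseDim k m : ℝ) (resonantSet r p.1.1 p.1.2) = 0 := by
    rintro ⟨⟨n, n'⟩, a, b, h⟩
    have h0 := hausdorffMeasure_resonantSet (r := r) hd h
    refine ⟨isClosed_resonantSet n n', ?_, ?_⟩
    · refine hasSmallInductiveDimensionLT_of_hausdorffMeasure_eq_zero _ _ ?_
      rw [← isometry_subtype_coe.hausdorffMeasure_image (Or.inl (Nat.cast_nonneg _)),
        Set.image_univ, Subtype.range_coe]
      exact h0
    · refine le_antisymm ((Measure.hausdorffMeasure_mono (Nat.cast_le.2 ?_) _).trans h0.le) zero_le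
      unfold phaseDim
      omega
  rcases isEmpty_or_nonempty {p : ((Fin 2 × Fin k) ⊕ Fin m → ℤ) × ((Fin 2 × Fin k) ⊕ Fin m → ℤ) //
    ∃ a b, p.1 a * p.2 b ≠ p.1 b * p.2 a} with he | hne
  · refine ⟨fun _ => ∅, fun _ => ⟨isClosed_empty, ?_, by simp⟩, by simp [doublyResonantSet]⟩
    infer_instance
  · obtain ⟨f, hf⟩ := exists_surjective_nat
      {p : ((Fin 2 × Fin k) ⊕ Fin m → ℤ) × ((Fin 2 × Fin k) ⊕ Fin m → ℤ) //
        ∃ a b, p.1 a * p.2 b ≠ p.1 b * p.2 a}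
    exact ⟨fun i => resonantSet r (f i).1.1 (f i).1.2, fun i => hall (f i),
      (hf.iUnion_comp fun p => resonantSet r p.1.1 p.1.2).symm.subset⟩

end TwoBalls

theorem UnitAddCircle.norm_coe_le_abs (x : ℝ) : ‖(x : UnitAddCircle)‖ ≤ |x| :=
  QuotientAddGroup.norm_mk_le_norm

/-! ### Unfolding the walls -/

namespace TwoBalls

variable {k m : ℕ} {r : ℝ}

/-- `x` are real coordinates of the configuration `q` unfolded in the walls, and `V` are the
velocities of these coordinates when the balls have the velocities `v`. The non-periodic
coordinates are halved, so that all unfolded coordinates have period `1`. -/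
def UnfoldsTo (q : Fin 2 → Center k m) (v : Fin 2 → Velocity k m)
    (x V : (Fin 2 × Fin k) ⊕ Fin m → ℝ) : Prop :=
  (∀ i j, ∃ σ : ℤ, (σ = 1 ∨ σ = -1) ∧ v i (Sum.inl j) = σ * (2 * V (Sum.inl (i, j))) ∧
    ∃ n : ℤ, (q i).1 j = σ * (2 * x (Sum.inl (i, j))) + 2 * n) ∧
  ∀ j, v 0 (Sum.inr j) - v 1 (Sum.inr j) = V (Sum.inr j) ∧
    (q 0).2 j - (q 1).2 j = (x (Sum.inr j) : UnitAddCircle)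

namespace UnfoldsTo

variable {q q' : Fin 2 → Center k m} {v w : Fin 2 → Velocity k m}
  {x V : (Fin 2 × Fin k) ⊕ Fin m → ℝ}

theorem of_coords (hp : ∀ i j, x (Sum.inl (i, j)) = (q i).1 j / 2)
    (hx : ∀ j, (q 0).2 j - (q 1).2 j = (x (Sum.inr j) : UnitAddCircle)) :
    UnfoldsTo q v x (frequency v) := by
  refine ⟨fun i j => ⟨1, Or.inl rfl, ?_, 0, ?_⟩, fun j => ⟨rfl, hx j⟩⟩
  · simp only [frequency, Sum.elim_inl]; push_cast; ring
  · rw [hp]; push_cast; ring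

theorem translate (h : UnfoldsTo q v x V) {s : ℝ}
    (hq : ∀ i, q' i = q i + toCenter (s • v i)) : UnfoldsTo q' v (fun c => x c + s * V c) V := by
  refine ⟨fun i j => ?_, fun j => ⟨(h.2 j).1, ?_⟩⟩
  · obtain ⟨σ, hσ, hv, n, hn⟩ := h.1 i j
    refine ⟨σ, hσ, hv, n, ?_⟩
    rw [hq i]
    simp only [toCenter, Prod.fst_add, Pi.add_apply, PiLp.smul_apply, smul_eq_mul]
    rw [hn, hv]
    ring
  · obtain ⟨hv, hx⟩ := h.2 j
    rw [hq 0, hq 1]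
    simp only [toCenter, Prod.snd_add, Pi.add_apply, PiLp.smul_apply, smul_eq_mul]
    rw [add_sub_add_comm, hx, ← AddCircle.coe_sub, ← AddCircle.coe_add, ← mul_sub, hv]

theorem reflect_wall (h : UnfoldsTo q v x V) {i : Fin 2} {j : Fin k}
    (ht : Touches r q (Piece.wall i j)) (hr : Reflects r q v w (Piece.wall i j)) :
    UnfoldsTo q w x V := by
  refine ⟨fun i' j' => ?_, fun j' => ⟨?_, (h.2 j').2⟩⟩
  · obtain ⟨σ, hσ, hv, n, hn⟩ := h.1 i' j'
    have hw := hr i' (Sum.inl j')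
    by_cases hij : i' = i ∧ j' = j
    · obtain ⟨rfl, rfl⟩ := hij
      rw [if_pos ⟨rfl, rfl⟩] at hw
      obtain ⟨e, he⟩ : ∃ e : ℤ, (q i').1 j' = e := by
        rcases ht with h0 | h1
        · exact ⟨0, by simpa using h0⟩
        · exact ⟨1, by simpa using h1⟩
      refine ⟨-σ, by omega, by rw [hw, hv]; push_cast; ring, e - n, ?_⟩
      rw [he] at hn ⊢
      push_cast
      linarith
    · rw [if_neg (fun hc => hij ⟨hc.1, Sum.inl_injective hc.2⟩)] at hw
      exact ⟨σ, hσ, hw.trans hv, n, hn⟩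
  · have h0 := hr 0 (Sum.inr j')
    have h1 := hr 1 (Sum.inr j')
    rw [if_neg (fun hc => by simp at hc)] at h0 h1
    rw [h0, h1]
    exact (h.2 j').1

/-- Wall reflections change frequencies only by signs, so integral relations survive folding. -/
theorem exists_frequency_eq (h : UnfoldsTo q v x V) :
    ∃ σ : (Fin 2 × Fin k) ⊕ Fin m → ℤ, ∀ c, σ c ≠ 0 ∧ V c = σ c * frequency v c := by
  have : ∀ c, ∃ σ : ℤ, σ ≠ 0 ∧ V c = σ * frequency v c := by
    rintro (⟨i, j⟩ | j)
    · obtain ⟨σ, hσ, hv, -⟩ := h.1 i j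
      refine ⟨σ, by omega, ?_⟩
      simp only [frequency, Sum.elim_inl, hv]
      rcases hσ with rfl | rfl <;> push_cast <;> ring
    · exact ⟨1, one_ne_zero, by simp [frequency, (h.2 j).1]⟩
  choose σ hσ using this
  exact ⟨σ, hσ⟩

end UnfoldsTo

/-- The squared distance of the centers as a function of the unfolded coordinates modulo `1`. -/
noncomputable def unfoldedDistSq (θ : UnitAddTorus ((Fin 2 × Fin k) ⊕ Fin m)) : ℝ :=
  ∑ j, (2 * ‖θ (Sum.inl (0, j))‖ - 2 * ‖θ (Sum.inl (1, j))‖) ^ 2 + ∑ j, ‖θ (Sum.inr j)‖ ^ 2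

theorem continuous_unfoldedDistSq : Continuous (unfoldedDistSq (k := k) (m := m)) := by
  unfold unfoldedDistSq
  fun_prop

theorem unfoldedDistSq_coe_le (x : (Fin 2 × Fin k) ⊕ Fin m → ℝ) :
    unfoldedDistSq (fun c => (x c : UnitAddCircle)) ≤
      ∑ j, (2 * x (Sum.inl (0, j)) - 2 * x (Sum.inl (1, j))) ^ 2 + ∑ j, x (Sum.inr j) ^ 2 := by
  refine add_le_add (Finset.sum_le_sum fun j _ => ?_) (Finset.sum_le_sum fun j _ => ?_)
  · rw [sq_le_sq, ← mul_sub, ← mul_sub, abs_mul, abs_mul]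
    refine mul_le_mul_of_nonneg_left ((abs_norm_sub_norm_le _ _).trans ?_) (abs_nonneg _)
    rw [← AddCircle.coe_sub]
    exact UnitAddCircle.norm_coe_le_abs _
  · rw [← sq_abs (x _)]
    exact pow_le_pow_left₀ (norm_nonneg _) (UnitAddCircle.norm_coe_le_abs _) 2

theorem UnfoldsTo.unfoldedDistSq_eq {q : Fin 2 → Center k m} {v : Fin 2 → Velocity k m}
    {x V : (Fin 2 × Fin k) ⊕ Fin m → ℝ} (h : UnfoldsTo q v x V) (hq : q ∈ configSpace k m r) :
    unfoldedDistSq (fun c => (x c : UnitAddCircle)) = centerDist (q 0) (q 1) ^ 2 := by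
  -- The norm on the circle is even and 1-periodic, hence blind to folding, and it is the identity
  -- on `[0, 1/2]`.
  have hfold : ∀ i j, 2 * ‖(x (Sum.inl (i, j)) : UnitAddCircle)‖ = (q i).1 j := by
    intro i j
    obtain ⟨σ, hσ, -, n, hn⟩ := h.1 i j
    have hI := hq.1 i j
    have h1 : ‖(x (Sum.inl (i, j)) : UnitAddCircle)‖ = ‖(((q i).1 j / 2 : ℝ) : UnitAddCircle)‖ := by
      have hn' : (q i).1 j / 2 = σ * x (Sum.inl (i, j)) + n := by rw [hn]; ring
      have hz : ((n : ℝ) : UnitAddCircle) = 0 :=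
        (AddCircle.coe_eq_zero_iff 1).2 ⟨n, by simp⟩
      rw [hn', AddCircle.coe_add, hz, add_zero]
      rcases hσ with rfl | rfl
      · simp
      · simp
    have h2 : ‖(((q i).1 j / 2 : ℝ) : UnitAddCircle)‖ = |(q i).1 j / 2| := by
      refine (AddCircle.norm_coe_eq_abs_iff (x := (q i).1 j / 2) 1 one_ne_zero).2 ?_
      rw [abs_of_nonneg (by linarith [hI.1]), abs_one]
      linarith [hI.2]
    rw [h1, h2, abs_of_nonneg (by linarith [hI.1])]
    ring
  rw [centerDist, Real.sq_sqrt (by positivity)]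
  simp only [unfoldedDistSq, hfold, fun j => (h.2 j).2]

/-! ### Trajectories without ball collisions after some time -/

namespace NonsingularTrajectory

variable (T : NonsingularTrajectory k m r)

theorem unfoldsTo_velOut_of_not_ballCollisionAt {t : ℝ} (ht : ¬ T.BallCollisionAt t)
    {x V : (Fin 2 × Fin k) ⊕ Fin m → ℝ} (h : UnfoldsTo (T.pos t) (T.velIn t) x V) :
    UnfoldsTo (T.pos t) (T.velOut t) x V := by
  by_cases hfree : ∀ p, ¬ Touches r (T.pos t) p
  · rwa [T.free t hfree]
  · push Not at hfree
    obtain ⟨p, hp⟩ := hfree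
    cases p with
    | wall i j => exact h.reflect_wall hp (T.reflect t _ hp)
    | balls =>
      have : T.velOut t = T.velIn t := by
        by_contra hne
        exact ht ⟨hp, hne⟩
      rwa [this]

theorem unfoldsTo_velIn_of_forall_lt {t t₁ : ℝ} (ht : t₁ < t)
    {x V : (Fin 2 × Fin k) ⊕ Fin m → ℝ}
    (h : ∀ s, t₁ ≤ s → s < t →
      UnfoldsTo (T.pos s) (T.velOut s) (fun c => x c + (s - t₁) * V c) V) :
    UnfoldsTo (T.pos t) (T.velIn t) (fun c => x c + (t - t₁) * V c) V := by
  obtain ⟨ε, hε, hb⟩ := T.before t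
  obtain ⟨s, hs0, hs⟩ := exists_between (lt_min hε (sub_pos.2 ht))
  obtain ⟨h1, -, h3⟩ := hb s hs0 (hs.trans_le (min_le_left _ _))
  have hst := hs.trans_le (min_le_right _ _)
  have h0 := h (t - s) (by linarith) (by linarith)
  rw [h3] at h0
  convert h0.translate (q' := T.pos t) (s := s) (fun i => by rw [h1 i]; abel) using 2
  ring

/-- Continuous induction: at the infimum of the bad times the unfolding persists by `before` and the
reflection law, and beyond it by `after`. -/
theorem unfoldsTo_velOut {t₁ : ℝ} (hT : ∀ t, t₁ < t → ¬ T.BallCollisionAt t)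
    {x V : (Fin 2 × Fin k) ⊕ Fin m → ℝ} (h : UnfoldsTo (T.pos t₁) (T.velOut t₁) x V) {t : ℝ}
    (ht : t₁ ≤ t) : UnfoldsTo (T.pos t) (T.velOut t) (fun c => x c + (t - t₁) * V c) V := by
  by_contra hbad
  set B := {t | t₁ ≤ t ∧
    ¬ UnfoldsTo (T.pos t) (T.velOut t) (fun c => x c + (t - t₁) * V c) V} with hB
  have hne : B.Nonempty := ⟨t, ht, hbad⟩
  have hbdd : BddBelow B := ⟨t₁, fun s hs => hs.1⟩
  set τ := sInf B with hτ
  have hτ₁ : t₁ ≤ τ := le_csInf hne fun s hs => hs.1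
  have hlt : ∀ s, t₁ ≤ s → s < τ →
      UnfoldsTo (T.pos s) (T.velOut s) (fun c => x c + (s - t₁) * V c) V := by
    intro s hs hsτ
    by_contra hns
    exact notMem_of_lt_csInf hsτ hbdd ⟨hs, hns⟩
  have hτgood : UnfoldsTo (T.pos τ) (T.velOut τ) (fun c => x c + (τ - t₁) * V c) V := by
    rcases hτ₁.eq_or_lt with heq | hlt'
    · rw [← heq]
      simpa using h
    · exact T.unfoldsTo_velOut_of_not_ballCollisionAt (hT τ hlt')
        (T.unfoldsTo_velIn_of_forall_lt hlt' hlt)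
  obtain ⟨ε, hε, ha⟩ := T.after τ
  obtain ⟨s, hs, hsε⟩ := exists_lt_of_csInf_lt hne (show sInf B < τ + ε by linarith)
  have hτs : τ ≤ s := csInf_le hbdd hs
  rcases hτs.eq_or_lt with heq | hlt'
  · exact hs.2 (heq ▸ hτgood)
  · obtain ⟨h1, -, h3⟩ := ha (s - τ) (by linarith) (by linarith)
    rw [add_sub_cancel] at h1 h3
    refine hs.2 ?_
    rw [h3]
    convert hτgood.translate h1 using 2
    ring

theorem unfoldsTo_velIn {t₁ : ℝ} (hT : ∀ t, t₁ < t → ¬ T.BallCollisionAt t)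
    {x V : (Fin 2 × Fin k) ⊕ Fin m → ℝ} (h : UnfoldsTo (T.pos t₁) (T.velOut t₁) x V) {t : ℝ}
    (ht : t₁ < t) : UnfoldsTo (T.pos t) (T.velIn t) (fun c => x c + (t - t₁) * V c) V :=
  T.unfoldsTo_velIn_of_forall_lt ht fun _ hs _ => T.unfoldsTo_velOut hT h hs

theorem le_unfoldedDistSq (hr : 0 < r) {t₁ : ℝ} (hT : ∀ t, t₁ < t → ¬ T.BallCollisionAt t)
    {x V : (Fin 2 × Fin k) ⊕ Fin m → ℝ} (h : UnfoldsTo (T.pos t₁) (T.velOut t₁) x V)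
    {y : (Fin 2 × Fin k) ⊕ Fin m → ℝ}
    (hy : ∀ n : (Fin 2 × Fin k) ⊕ Fin m → ℤ, ∑ c, n c * V c = 0 →
      ∃ e : ℤ, ∑ c, (n c : ℝ) * (y c - x c) = e) :
    (2 * r) ^ 2 ≤ unfoldedDistSq (fun c => (y c : UnitAddCircle)) := by
  by_contra! hlt
  obtain ⟨t, ht, htU⟩ := UnitAddTorus.exists_gt_linear_flow_mem hy
    (isOpen_lt continuous_unfoldedDistSq continuous_const) hlt 0
  have hu := T.unfoldsTo_velOut hT h (t := t₁ + t) (by linarith)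
  have hmem := T.pos_mem (t₁ + t)
  have heq := hu.unfoldedDistSq_eq hmem
  rw [add_sub_cancel_left] at heq
  refine absurd (show unfoldedDistSq _ < (2 * r) ^ 2 from htU) (not_lt.2 ?_)
  rw [heq]
  exact pow_le_pow_left₀ (by positivity) hmem.2.1 2

theorem not_ballCollisionAt_of_forall_gt (hr : 0 < r) {t₁ : ℝ}
    (hT : ∀ t, t₁ < t → ¬ T.BallCollisionAt t) : ¬ T.BallCollisionAt t₁ := by
  rintro ⟨htouch, hne⟩
  obtain ⟨u, hu, hnorm, h0, h1⟩ := T.reflect t₁ _ htouch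
  set w := T.velOut t₁ 0 - T.velOut t₁ 1 with hw
  set a := inner ℝ (T.velIn t₁ 0 - T.velIn t₁ 1) u with ha
  have hinner : inner ℝ u w = -a := by
    have hw' : w = (T.velIn t₁ 0 - T.velIn t₁ 1) - (2 * (a / (2 * r) ^ 2)) • u := by
      rw [hw, h0, h1]
      module
    rw [hw', inner_sub_right, real_inner_comm, ← ha, inner_smul_right, real_inner_self_eq_norm_sq,
      hnorm]
    field_simp
    ring
  have ha0 : a ≠ 0 := by
    intro ha0
    rw [ha0, zero_div, zero_smul] at h0 h1
    refine hne (funext fun i => ?_)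
    fin_cases i
    · simpa using h0
    · simpa using h1
  let x : (Fin 2 × Fin k) ⊕ Fin m → ℝ :=
    Sum.elim (fun p => (T.pos t₁ p.1).1 p.2 / 2) fun j => u (Sum.inr j)
  have hx : UnfoldsTo (T.pos t₁) (T.velOut t₁) x (frequency (T.velOut t₁)) :=
    UnfoldsTo.of_coords (fun _ _ => rfl) fun j => (congrFun (congrArg Prod.snd hu) j).symm
  have hge : ∀ s : ℝ, (2 * r) ^ 2 ≤ ‖u + s • w‖ ^ 2 := by
    intro s
    -- Points of the flow line satisfy every relation exactly, for negative `s` too; this is where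
    -- the future controls the past.
    have hle := T.le_unfoldedDistSq hr hT hx (y := fun c => x c + s * frequency (T.velOut t₁) c)
      (fun n hn => ⟨0, by
        simp only [add_sub_cancel_left, Int.cast_zero]
        rw [← mul_zero s, ← hn, Finset.mul_sum]
        exact Finset.sum_congr rfl fun c _ => by ring⟩)
    refine (hle.trans (unfoldedDistSq_coe_le _)).trans_eq ?_
    rw [EuclideanSpace.norm_sq_eq, Fintype.sum_sum_type]
    congr 1
    · refine Finset.sum_congr rfl fun j _ => ?_
      have huj : u (Sum.inl j) = (T.pos t₁ 0).1 j - (T.pos t₁ 1).1 j :=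
        congrFun (congrArg Prod.fst hu) j
      simp only [x, frequency, Sum.elim_inl, Real.norm_eq_abs, sq_abs, PiLp.add_apply,
        PiLp.smul_apply, smul_eq_mul, hw, PiLp.sub_apply, huj]
      ring
    · refine Finset.sum_congr rfl fun j _ => ?_
      simp only [x, frequency, Sum.elim_inr, Real.norm_eq_abs, sq_abs, PiLp.add_apply,
        PiLp.smul_apply, smul_eq_mul, hw, PiLp.sub_apply]
  -- This is `‖u + s • w‖ ^ 2 - ‖u‖ ^ 2`; a double root at `s = 0` forces `a = 0`, a grazing
  -- contact.
  have hquad : ∀ s : ℝ, 0 ≤ ‖w‖ ^ 2 * (s * s) + (-(2 * a)) * s + 0 := by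
    intro s
    have := hge s
    rw [norm_add_sq_real, hnorm, inner_smul_right, hinner, norm_smul, mul_pow ‖s‖,
      Real.norm_eq_abs, sq_abs] at this
    linarith
  have hdisc := discrim_le_zero hquad
  rw [discrim] at hdisc
  have : 0 < a ^ 2 := by positivity
  nlinarith

theorem not_ballCollisionAt (hr : 0 < r) {t₀ : ℝ} (hT : ∀ t, t₀ < t → ¬ T.BallCollisionAt t)
    (t : ℝ) : ¬ T.BallCollisionAt t := by
  intro ht
  set C := {t | T.BallCollisionAt t} with hC
  have hne : C.Nonempty := ⟨t, ht⟩
  have hbdd : BddAbove C := ⟨t₀, fun s hs => not_lt.1 fun h => hT s h hs⟩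
  -- Just before the supremum velocities do not jump, so a collision this close to it is the last
  -- one.
  obtain ⟨ε, hε, hb⟩ := T.before (sSup C)
  obtain ⟨s, hs, hsε⟩ := exists_lt_of_lt_csSup hne (show sSup C - ε < sSup C by linarith)
  have hle : s ≤ sSup C := le_csSup hbdd hs
  refine T.not_ballCollisionAt_of_forall_gt hr (t₁ := s) (fun s' hs' hcol => ?_) hs
  have hle' : s' ≤ sSup C := le_csSup hbdd hcol
  obtain ⟨-, h2, h3⟩ := hb (sSup C - s) (by linarith) (by linarith)
  rw [sub_sub_cancel] at h2 h3
  exact hs.2 (h3.trans h2.symm)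

end NonsingularTrajectory

/-! ### Relations of the frequencies and overlapping configurations -/

theorem mem_doublyResonantSet_of_unfoldsTo {s : phaseSpace k m r}
    {x V : (Fin 2 × Fin k) ⊕ Fin m → ℝ} (h : UnfoldsTo s.1.1 s.1.2 x V)
    {n n' : (Fin 2 × Fin k) ⊕ Fin m → ℤ} (hn : ∑ c, n c * V c = 0) (hn' : ∑ c, n' c * V c = 0)
    {a b : (Fin 2 × Fin k) ⊕ Fin m} (hab : n a * n' b ≠ n b * n' a) :
    s ∈ doublyResonantSet k m r := by
  obtain ⟨σ, hσ⟩ := h.exists_frequency_eq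
  refine Set.mem_iUnion.2 ⟨⟨(fun c => n c * σ c, fun c => n' c * σ c), a, b, fun heq => hab ?_⟩,
    ?_, ?_⟩
  · refine mul_right_cancel₀ (mul_ne_zero (hσ a).1 (hσ b).1) ?_
    linear_combination heq
  · refine Eq.trans (Finset.sum_congr rfl fun c _ => ?_) hn
    rw [(hσ c).2]; push_cast; ring
  · refine Eq.trans (Finset.sum_congr rfl fun c _ => ?_) hn'
    rw [(hσ c).2]; push_cast; ring

/-- Unfolded coordinates `ξ` and `±ξ` fold to the same point. For one of the signs `n · y` is a
nonzero multiple of `ξ`, so it takes any prescribed value. -/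
theorem exists_unfoldedDistSq_eq_zero {n : (Fin 2 × Fin k) ⊕ Fin m → ℤ} {i : Fin 2} {j : Fin k}
    (hn : n (Sum.inl (i, j)) ≠ 0) (c : ℝ) :
    ∃ y : (Fin 2 × Fin k) ⊕ Fin m → ℝ, ∑ e, n e * y e = c ∧
      unfoldedDistSq (fun e => (y e : UnitAddCircle)) = 0 := by
  obtain ⟨σ, hσ, hN⟩ : ∃ σ : ℤ, (σ = 1 ∨ σ = -1) ∧
      n (Sum.inl (0, j)) + σ * n (Sum.inl (1, j)) ≠ 0 := by
    by_contra! hcon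
    have h1 := hcon 1 (Or.inl rfl)
    have h2 := hcon (-1) (Or.inr rfl)
    fin_cases i
    · exact hn (by simp only [Fin.zero_eta]; omega)
    · exact hn (by simp only [Fin.mk_one]; omega)
  have hN' : (n (Sum.inl (0, j)) + σ * n (Sum.inl (1, j)) : ℝ) ≠ 0 := by exact_mod_cast hN
  set ξ : ℝ := c / (n (Sum.inl (0, j)) + σ * n (Sum.inl (1, j))) with hξ
  refine ⟨Sum.elim (fun p => if p.2 = j then (if p.1 = 0 then ξ else σ * ξ) else 0) fun _ => 0,
    ?_, ?_⟩
  · rw [Fintype.sum_sum_type, Fintype.sum_prod_type, Fin.sum_univ_two]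
    simp only [Sum.elim_inl, Sum.elim_inr, mul_ite, mul_zero, Finset.sum_ite_eq', Finset.mem_univ,
      if_true, one_ne_zero, if_false, Finset.sum_const_zero, add_zero]
    rw [hξ]
    field_simp
  · simp only [unfoldedDistSq, Sum.elim_inl, Sum.elim_inr, AddCircle.coe_zero, norm_zero]
    simp only [one_ne_zero, if_false, if_true, ne_eq, OfNat.ofNat_ne_zero, not_false_eq_true,
      zero_pow, Finset.sum_const_zero, add_zero]
    refine Finset.sum_eq_zero fun j' _ => ?_
    split_ifs
    · rcases hσ with rfl | rfl <;> simp
    · simp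

theorem exists_unfoldedDistSq_lt {n : (Fin 2 × Fin k) ⊕ Fin m → ℤ}
    (hn : ∀ p, n (Sum.inl p) = 0)
    (hbig : 1 < (4 * r) ^ 2 * ∑ j, (n (Sum.inr j) : ℝ) ^ 2) (c : ℝ) :
    ∃ y : (Fin 2 × Fin k) ⊕ Fin m → ℝ, (∃ e : ℤ, ∑ i, n i * y i - c = e) ∧
      unfoldedDistSq (fun e => (y e : UnitAddCircle)) < (2 * r) ^ 2 := by
  set S := ∑ j, (n (Sum.inr j) : ℝ) ^ 2 with hS
  have hSpos : 0 < S := by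
    by_contra! hS0
    nlinarith [sq_nonneg (4 * r)]
  -- The foot of the perpendicular from the origin to the nearest hyperplane `n · y ∈ c + ℤ`; its
  -- length is at most `1 / (2 √S) < 2r`.
  refine ⟨Sum.elim (fun _ => 0) fun j => (c - round c) / S * n (Sum.inr j), ⟨-round c, ?_⟩, ?_⟩
  · rw [Fintype.sum_sum_type]
    simp only [hn, Sum.elim_inl, Sum.elim_inr, mul_zero, Finset.sum_const_zero, zero_add]
    have : ∑ j, (n (Sum.inr j) : ℝ) * ((c - round c) / S * n (Sum.inr j)) = c - round c := by
      refine Eq.trans ?_ (div_mul_cancel₀ (c - round c : ℝ) hSpos.ne')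
      refine Eq.trans (Finset.sum_congr rfl fun j _ => ?_) (Finset.mul_sum _ _ _).symm
      ring
    rw [this]
    push_cast
    ring
  · refine (unfoldedDistSq_coe_le _).trans_lt ?_
    simp only [Sum.elim_inl, Sum.elim_inr, sub_self, ne_eq, OfNat.ofNat_ne_zero,
      not_false_eq_true, zero_pow, Finset.sum_const_zero, zero_add, mul_pow]
    rw [← Finset.mul_sum, ← hS]
    have hround : (c - round c) ^ 2 ≤ (1 / 2) ^ 2 :=
      sq_le_sq.2 ((abs_sub_round c).trans (le_abs_self _))
    have : ((c - round c) / S) ^ 2 * S = (c - round c) ^ 2 / S := by field_simp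
    rw [this, div_lt_iff₀ hSpos]
    nlinarith

end TwoBalls

/-! ### The finite list of exceptional directions and the dichotomy -/

namespace TwoBalls

variable {k m : ℕ} {r : ℝ}

/-- The nonzero integral vectors of length at most `1 / (4 r)`. -/
def shortVectors (m : ℕ) (r : ℝ) : Set (Fin m → ℤ) :=
  {z | z ≠ 0 ∧ (4 * r) ^ 2 * ∑ j, (z j : ℝ) ^ 2 ≤ 1}

theorem finite_shortVectors (hr : 0 < r) : (shortVectors m r).Finite := by
  refine (Set.finite_Icc (fun _ : Fin m => -⌈1 / (4 * r)⌉) fun _ => ⌈1 / (4 * r)⌉).subset ?_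
  rintro z ⟨-, hz⟩
  have hle : ∀ j, |(z j : ℝ)| ≤ ⌈1 / (4 * r)⌉ := by
    intro j
    refine le_trans ?_ (Int.le_ceil _)
    have h1 : (z j : ℝ) ^ 2 ≤ ∑ j, (z j : ℝ) ^ 2 :=
      Finset.single_le_sum (f := fun j => (z j : ℝ) ^ 2) (fun _ _ => sq_nonneg _)
        (Finset.mem_univ j)
    refine abs_le_of_sq_le_sq ?_ (by positivity)
    rw [div_pow, one_pow, le_div_iff₀ (by positivity)]
    nlinarith [sq_nonneg (4 * r)]
  refine ⟨fun j => ?_, fun j => ?_⟩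
  · exact_mod_cast (abs_le.1 (hle j)).1
  · exact_mod_cast (abs_le.1 (hle j)).2

theorem NonsingularTrajectory.minors_eq_zero_or_exists_shortVector
    (T : NonsingularTrajectory k m r) (hr : 0 < r) {t₁ : ℝ}
    (hT : ∀ t, t₁ < t → ¬ T.BallCollisionAt t)
    {x V : (Fin 2 × Fin k) ⊕ Fin m → ℝ} (h : UnfoldsTo (T.pos t₁) (T.velOut t₁) x V) :
    (∃ n n' : (Fin 2 × Fin k) ⊕ Fin m → ℤ, ∑ c, n c * V c = 0 ∧ ∑ c, n' c * V c = 0 ∧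
      ∃ a b, n a * n' b ≠ n b * n' a) ∨
    ∃ z ∈ shortVectors m r, ∑ j, z j * V (Sum.inr j) = 0 := by
  rw [or_iff_not_imp_left]
  intro hΛ
  push Not at hΛ
  let Λ : AddSubgroup ((Fin 2 × Fin k) ⊕ Fin m → ℤ) :=
    { carrier := {n | ∑ c, n c * V c = 0}
      zero_mem' := by simp
      add_mem' := fun {n n'} hn hn' => by
        simp only [Set.mem_ofPred_eq, Pi.add_apply, Int.cast_add, add_mul,
          Finset.sum_add_distrib] at *
        rw [hn, hn', add_zero]
      neg_mem' := fun {n} hn => by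
        simp only [Set.mem_ofPred_eq, Pi.neg_apply, Int.cast_neg, neg_mul,
          Finset.sum_neg_distrib] at *
        rw [hn, neg_zero] }
  obtain ⟨n₀, hn₀, hgen⟩ := Λ.exists_forall_eq_zsmul_of_minors_eq_zero
    fun n hn n' hn' a b => hΛ n n' hn hn' a b
  have hn₀V : ∑ c, n₀ c * V c = 0 := hn₀
  have key : ∀ y : (Fin 2 × Fin k) ⊕ Fin m → ℝ,
      (∃ e : ℤ, ∑ c, n₀ c * y c - ∑ c, n₀ c * x c = e) →
      (2 * r) ^ 2 ≤ unfoldedDistSq (fun c => (y c : UnitAddCircle)) := by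
    rintro y ⟨e, he⟩
    refine T.le_unfoldedDistSq hr hT h fun n hn => ?_
    obtain ⟨c, rfl⟩ := hgen n hn
    refine ⟨c * e, ?_⟩
    rw [Int.cast_mul, ← he, mul_sub, Finset.mul_sum, Finset.mul_sum, ← Finset.sum_sub_distrib]
    refine Finset.sum_congr rfl fun i _ => ?_
    simp only [Pi.smul_apply, smul_eq_mul]
    push_cast
    ring
  have hrpos : 0 < (2 * r) ^ 2 := by positivity
  by_cases hinl : ∀ p, n₀ (Sum.inl p) = 0
  · refine ⟨fun j => n₀ (Sum.inr j), ⟨fun hz => ?_, ?_⟩, ?_⟩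
    -- For `n₀ = 0` the orbit is dense and approaches coinciding centers.
    · have hall : ∀ c, n₀ c = 0 := by
        rintro (p | j)
        · exact hinl p
        · exact congrFun hz j
      have := key (fun _ => 0) ⟨0, by simp [hall]⟩
      simp [unfoldedDistSq] at this
      linarith
    · by_contra! hbig
      obtain ⟨y, hy, hlt⟩ := exists_unfoldedDistSq_lt hinl hbig (∑ c, n₀ c * x c)
      exact absurd (key y hy) (not_le.2 hlt)
    · rw [Fintype.sum_sum_type] at hn₀V
      simpa [hinl] using hn₀V
  · push Not at hinl
    obtain ⟨⟨i, j⟩, hij⟩ := hinl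
    obtain ⟨y, hy, h0⟩ := exists_unfoldedDistSq_eq_zero hij (∑ c, n₀ c * x c)
    have := key y ⟨0, by rw [hy]; simp⟩
    linarith

end TwoBalls

theorem lemma4p1 (ν k : ℕ) (r : ℝ) (hν : 2 ≤ ν) (hk : 1 ≤ k) (hkν : k ≤ ν)
    (hr : 0 < r) (hr' : r < 1 / 4) :
    ∃ (l : ℕ) (z : Fin l → EuclideanSpace ℝ (Fin (ν - k)))
      (E : Set (TwoBalls.phaseSpace k (ν - k) r)),
      (∀ i, z i ≠ 0) ∧ TwoBalls.IsSlim E ∧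
      ∀ (T : TwoBalls.NonsingularTrajectory k (ν - k) r) (t₀ : ℝ),
        (∀ t, t₀ < t → ¬ T.BallCollisionAt t) →
          ((T.stateIn 0 ∈ E ∧ T.stateOut 0 ∈ E) ∨
            ∃ i, inner ℝ (TwoBalls.periodicPart (T.velOut t₀ 0 - T.velOut t₀ 1)) (z i) = 0) ∧
          ∀ t, ¬ T.BallCollisionAt t := by
  obtain ⟨l, f, hf⟩ := (TwoBalls.finite_shortVectors (m := ν - k) hr).fin_param
  refine ⟨l, fun i => WithLp.toLp 2 fun j => (f i j : ℝ), TwoBalls.doublyResonantSet k (ν - k) r,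
    fun i hi => ?_, TwoBalls.isSlim_doublyResonantSet (by omega), fun T t₀ hT => ?_⟩
  · refine (hf.2 ▸ Set.mem_range_self i : f i ∈ TwoBalls.shortVectors (ν - k) r).1 ?_
    funext j
    have := congrFun (congrArg WithLp.ofLp hi) j
    simpa using this
  have hnever := T.not_ballCollisionAt hr hT
  refine ⟨?_, hnever⟩
  -- Starting before both times covers time `0` and time `t₀` with one unfolding; `t₁ < 0` strictly
  -- is needed for the incoming representative at time `0`.
  set t₁ := min 0 t₀ - 1 with ht₁
  have h0 : t₁ < 0 := by linarith [min_le_left 0 t₀]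
  have h0' : t₁ < t₀ := by linarith [min_le_right 0 t₀]
  choose y hy using fun j =>
    QuotientAddGroup.mk_surjective ((T.pos t₁ 0).2 j - (T.pos t₁ 1).2 j)
  have hx : TwoBalls.UnfoldsTo (T.pos t₁) (T.velOut t₁)
      (Sum.elim (fun p => (T.pos t₁ p.1).1 p.2 / 2) y) (TwoBalls.frequency (T.velOut t₁)) :=
    TwoBalls.UnfoldsTo.of_coords (fun _ _ => rfl) fun j => (hy j).symm
  have hT₁ : ∀ t, t₁ < t → ¬ T.BallCollisionAt t := fun t _ => hnever t
  rcases T.minors_eq_zero_or_exists_shortVector hr hT₁ hx with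
    ⟨n, n', hn, hn', a, b, hab⟩ | ⟨z, hz, hzV⟩
  · exact Or.inl ⟨
      TwoBalls.mem_doublyResonantSet_of_unfoldsTo (T.unfoldsTo_velIn hT₁ hx h0) hn hn' hab,
      TwoBalls.mem_doublyResonantSet_of_unfoldsTo (T.unfoldsTo_velOut hT₁ hx h0.le) hn hn' hab⟩
  · right
    rw [← hf.2] at hz
    obtain ⟨i, rfl⟩ := hz
    refine ⟨i, ?_⟩
    rw [PiLp.inner_apply, ← hzV]
    refine Finset.sum_congr rfl fun j _ => ?_
    have hv := ((T.unfoldsTo_velOut hT₁ hx h0'.le).2 j).1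
    simp only [TwoBalls.periodicPart, PiLp.sub_apply, hv]
    simp
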